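/- **Temporal formulas.** Temporal formulas are built from propositional letters by $\neg,\vee,\mathbf F,\mathbf P$, with $\mathbf G=\neg\mathbf F\neg$ and $\mathbf H=\neg\mathbf P\neg$. In a frame $(W,R)$ with a valuation $v$ assigning to each letter a subset of $W$, $\mathbf F\varphi$ (respectively $\mathbf P\varphi$) holds at $x$ iff $\varphi$ holds at some $y$ with $xRy$ (respectively $yRx$). A formula is *satisfiable in* $(W,R)$ if it holds at some point of $W$ under some valuation. **The formula $\Delta(\mathcal P)$.** For a finite non-empty partial order $\mathcal P=(P,\le)$ with strict part $<$, taking the points of $P$ as propositional letters, let $$\Delta(\mathcal P)=\mathbf G\mathbf H\Big[\bigvee P\;\wedge\bigwedge_{p\ne q}\neg(p\wedge q)\;\wedge\bigwedge_{p\neq q,\;p<q}\big((p\to\mathbf F q)\wedge(q\to\mathbf P p)\big)\;\wedge\bigwedge_{p\ne q,\;p\not<q}\big((p\to\mathbf G\neg q)\wedge(q\to\mathbf H\neg p)\big)\Big].$$ **The posets.** $\mathcal P_1$ has the ten elements $u$, $p_i^-$, $p_i^+$ $(0\le i<4)$ and $s$; its order consists of the four chains $u<p_i^-<p_i^+<s$,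 with no other comparabilities. $\mathcal P_2$ has the seven elements $u,p_0,p_1,q_0,q_1,q_2,s$; in it $u$ lies below $p_0$ and $p_1$, each $p_i$ lies below each $q_j$, each $q_j$ lies below $s$, together with the comparabilities that follow by transitivity and no others. ($\mathcal P_1$ is a non-distributive lattice, and $\mathcal P_2$ is not a lattice.) **The frames.** For $F=\mathbb R$ or $F=\mathbb Q$, three-dimensional Minkowski spacetime is $F^3$ with points $(u,v,t)$ and $$(u,v,t)\le(u',v',t')\iff t\le t'\ \text{ and }\ (u'-u)^2+(v'-v)^2\le(t'-t)^2 .$$ Two-dimensional Minkowski spacetime is $F^2$ with points $(u,t)$ and $(u,t)\le(u',t')\iff|u'-u|\le t'-t$, or equivalently, in light-line coordinates, $F^2$ with the product order $(x,y)\le(x',y')\iff x\le x'\wedge y\le y'$ (the assertions below hold for both presentations). In all cases $\mathsf x<\mathsf y$ means $\mathsf x\le\mathsf y$ and $\mathsf x\ne\mathsf y$. **Theorem.** 1. $\Delta(\mathcal P_1)$ is satisfiable in $(\mathbb Q^2,\le)$ and in $(\mathbb Q^2,<)$, but neither in $(\mathbb R^2,\le)$ nor in $(\mathbb R^2,<)$.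 2. For $F=\mathbb R$ and for $F=\mathbb Q$, $\Delta(\mathcal P_2)$ is satisfiable in $(F^3,\le)$ and in $(F^3,<)$, but neither in $(F^2,\le)$ nor in $(F^2,<)$. -/

import Mathlib

/-- Temporal propositional formulas over a set `α` of propositional letters, generated by
negation, disjunction and the operators `F` (`future`) and `P` (`past`). -/
inductive TForm (α : Type) : Type
  | letter (a : α) : TForm α
  | neg (φ : TForm α) : TForm α
  | disj (φ ψ : TForm α) : TForm α
  | future (φ : TForm α) : TForm α
  | past (φ : TForm α) : TForm α

namespace TForm

variable {α : Type}

/-- `φ ∧ ψ = ¬(¬φ ∨ ¬ψ)`. -/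
def conj (φ ψ : TForm α) : TForm α := neg (disj (neg φ) (neg ψ))

/-- `φ → ψ = ¬φ ∨ ψ`. -/
def imp (φ ψ : TForm α) : TForm α := disj (neg φ) ψ

/-- `G φ = ¬ F ¬ φ`. -/
def always (φ : TForm α) : TForm α := neg (future (neg φ))

/-- `H φ = ¬ P ¬ φ`. -/
def hasBeen (φ : TForm α) : TForm α := neg (past (neg φ))

/-- Disjunction of a finite list; the empty disjunction is a contradiction. -/
def bigDisj [Inhabited α] : List (TForm α) → TForm α
  | [] => conj (letter default) (neg (letter default))
  | [φ] => φ
  | φ :: ψ :: l => disj φ (bigDisj (ψ :: l))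

/-- Conjunction of a finite list; the empty conjunction is a tautology. -/
def bigConj [Inhabited α] : List (TForm α) → TForm α
  | [] => disj (letter default) (neg (letter default))
  | [φ] => φ
  | φ :: ψ :: l => conj φ (bigConj (ψ :: l))

/-- Truth of a formula at a point `x` of the Kripke structure `(W, R, v)`. -/
def Holds {W : Type} (R : W → W → Prop) (v : α → Set W) : W → TForm α → Prop
  | x, letter a => x ∈ v a
  | x, neg φ => ¬ Holds R v x φ
  | x, disj φ ψ => Holds R v x φ ∨ Holds R v x ψ
  | x, future φ => ∃ y, R x y ∧ Holds R v y φ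
  | x, past φ => ∃ y, R y x ∧ Holds R v y φ

/-- `φ` is satisfiable in the frame `(W, R)`. -/
def SatisfiableIn {W : Type} (R : W → W → Prop) (φ : TForm α) : Prop :=
  ∃ (v : α → Set W) (x : W), Holds R v x φ

end TForm

open TForm in
open Classical in
/-- The formula `Δ(P)` of a finite non-empty partial order `P`, whose points serve as
propositional letters:
`G H [ ⋁ P ∧ ⋀_{p ≠ q} ¬(p ∧ q) ∧ ⋀_{p ≠ q, p < q} (p → F q) ∧ (q → P p)
  ∧ ⋀_{p ≠ q, p ≮ q} (p → G ¬q) ∧ (q → H ¬p) ]`. -/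
noncomputable def deltaFormula (P : Type) [PartialOrder P] [Fintype P] [Inhabited P] : TForm P :=
  let points : List P := Finset.univ.toList
  let pairs : List (P × P) := (Finset.univ.filter fun c : P × P => c.1 ≠ c.2).toList
  always (hasBeen (bigConj [
    bigDisj (points.map letter),
    bigConj (pairs.map fun c => neg (conj (letter c.1) (letter c.2))),
    bigConj ((pairs.filter fun c => c.1 < c.2).map fun c =>
      conj (imp (letter c.1) (future (letter c.2))) (imp (letter c.2) (past (letter c.1)))),
    bigConj ((pairs.filter fun c => ¬ c.1 < c.2).map fun c =>
      conj (imp (letter c.1) (always (neg (letter c.2))))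
        (imp (letter c.2) (hasBeen (neg (letter c.1)))))]))

/-- The ten points of the first poset: `u`, `pMinus i`, `pPlus i` (`i < 4`) and `s`. -/
inductive Poset1 : Type
  | u : Poset1
  | pMinus (i : Fin 4) : Poset1
  | pPlus (i : Fin 4) : Poset1
  | s : Poset1
  deriving DecidableEq, Fintype

namespace Poset1

instance : Inhabited Poset1 := ⟨u⟩

/-- Four chains `u < pMinus i < pPlus i < s`, with no other comparabilities. -/
def le : Poset1 → Poset1 → Prop
  | u, _ => True
  | _, s => True
  | pMinus i, pMinus j => i = j
  | pMinus i, pPlus j => i = j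
  | pPlus i, pPlus j => i = j
  | _, _ => False

instance : PartialOrder Poset1 where
  le := le
  le_refl a := by cases a <;> simp [le]
  le_trans a b c := by cases a <;> cases b <;> cases c <;> simp [le] <;> intros <;> simp_all
  le_antisymm a b := by cases a <;> cases b <;> simp [le] <;> intros <;> simp_all

end Poset1

/-- The seven points of the second poset: `u`, `p 0`, `p 1`, `q 0`, `q 1`, `q 2` and `s`. -/
inductive Poset2 : Type
  | u : Poset2
  | p (i : Fin 2) : Poset2
  | q (i : Fin 3) : Poset2
  | s : Poset2
  deriving DecidableEq, Fintype

namespace Poset2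

instance : Inhabited Poset2 := ⟨u⟩

def level : Poset2 → ℕ
  | u => 0
  | p _ => 1
  | q _ => 2
  | s => 3

/-- `u` is below both `p i`, each `p i` is below every `q j`, and each `q j` is below `s`. -/
def le (a b : Poset2) : Prop := a = b ∨ level a < level b

instance : PartialOrder Poset2 where
  le := le
  le_refl a := Or.inl rfl
  le_trans a b c h₁ h₂ := by
    rcases h₁ with rfl | h₁
    · exact h₂
    · rcases h₂ with rfl | h₂
      · exact Or.inr h₁
      · exact Or.inr (h₁.trans h₂)
  le_antisymm a b h₁ h₂ := by
    rcases h₁ with h₁ | h₁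
    · exact h₁
    · rcases h₂ with h₂ | h₂
      · exact h₂.symm
      · exact absurd h₁ h₂.asymm

end Poset2

/-- The partial order `P` is a lattice. -/
def IsLatticeOrder (P : Type) [PartialOrder P] : Prop :=
  ∀ a b : P, (∃ c, IsLUB {a, b} c) ∧ ∃ c, IsGLB {a, b} c

/-- The distributive law `a ∧ (b ∨ c) = (a ∧ b) ∨ (a ∧ c)` in a lattice-ordered set. -/
def IsDistributiveOrder (P : Type) [PartialOrder P] : Prop :=
  ∀ a b c j m m₁ m₂ : P, IsLUB {b, c} j → IsGLB {a, j} m →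
    IsGLB {a, b} m₁ → IsGLB {a, c} m₂ → IsLUB {m₁, m₂} m

/-- `(d+1)`-dimensional Minkowski spacetime over `K`: `d` space coordinates and one time
coordinate. -/
abbrev Minkowski (K : Type) (d : ℕ) : Type := (Fin d → K) × K

namespace Minkowski

variable (K : Type) [Field K] [LinearOrder K] [IsStrictOrderedRing K] (d : ℕ)

/-- `a` can send a signal to `b` at the speed of light or less: the Euclidean distance of the
space parts is at most the elapsed time. -/
def Causal (a b : Minkowski K d) : Prop :=
  a.2 ≤ b.2 ∧ ∑ i, (b.1 i - a.1 i) ^ 2 ≤ (b.2 - a.2) ^ 2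

/-- The irreflexive restriction of `Causal`. -/
def StrictCausal (a b : Minkowski K d) : Prop := Causal K d a b ∧ a ≠ b

/-- The same relation on two-dimensional spacetime in light-line coordinates
`(time + space, time - space)` (up to scaling): the product order. -/
def LightCausal (a b : K × K) : Prop := a.1 ≤ b.1 ∧ a.2 ≤ b.2

/-- The irreflexive restriction of `LightCausal`. -/
def StrictLightCausal (a b : K × K) : Prop := LightCausal K a b ∧ a ≠ b

end Minkowski

/-! All these frames are directed upwards, so the prefix `G H` reaches every point, and
`deltaFormula P` is satisfiable exactly when the frame has a tense morphism to `P`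
(`satisfiableIn_deltaFormula_iff`). Only strict inequalities in `P` call for witnesses, so the
reflexive and the irreflexive frame have the same morphisms. In the plane, light-line coordinates
turn causality into the product order.

The second poset fails in the plane because the plane has joins. Take `x` labelled `p 0` and points
labelled `q 0`, `q 1`, `q 2` above it; these form an antichain, so one lies in the middle. A point
`z` labelled `p 1` below the middle one has a join with `x` that lies below two differently labelled
`q`-points, and no label fits it. With one more space dimension, light-like coordinates `x, y` and a
transverse coordinate `v`, the joins disappear: the boundary of the quadrant `x, y ≥ 0` is coloured
by `v`, and causally related boundary points have equal `v`.

For the first poset, a morphism on the real plane gives every line `x - y = t` a point in one of the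
four middle chains (`exists_mid_on_line`, by completeness), hence a colour `c t`. The two elements
of a chain make `c` constant on one side of each `t`, and joins put a third colour between any two.
The set where `c` is not locally constant is then perfect and countable, hence empty
(`eq_of_oneSided_of_between`), although all four colours occur. Over the rationals, Cantor's
isomorphism of `ℚ` with its lexicographic square gives every point of the antidiagonal a thick
fibre: the major coordinates choose the chain, the minor one chooses the lower or upper element. -/

/-! ### Semantics of the derived connectives -/

namespace TForm

variable {α W : Type} {R : W → W → Prop} {v : α → Set W} {x : W} {φ ψ : TForm α}

@[simp] lemma holds_letter {a : α} : Holds R v x (letter a) ↔ x ∈ v a := Iff.rfl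

@[simp] lemma holds_neg : Holds R v x (neg φ) ↔ ¬ Holds R v x φ := Iff.rfl

@[simp] lemma holds_disj : Holds R v x (disj φ ψ) ↔ Holds R v x φ ∨ Holds R v x ψ := Iff.rfl

@[simp] lemma holds_future : Holds R v x (future φ) ↔ ∃ y, R x y ∧ Holds R v y φ := Iff.rfl

@[simp] lemma holds_past : Holds R v x (past φ) ↔ ∃ y, R y x ∧ Holds R v y φ := Iff.rfl

@[simp] lemma holds_conj : Holds R v x (conj φ ψ) ↔ Holds R v x φ ∧ Holds R v x ψ := by
  simp [conj]

@[simp] lemma holds_imp : Holds R v x (imp φ ψ) ↔ (Holds R v x φ → Holds R v x ψ) := by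
  simp only [imp, holds_disj, holds_neg]; tauto

@[simp] lemma holds_always : Holds R v x (always φ) ↔ ∀ y, R x y → Holds R v y φ := by
  simp [always]

@[simp] lemma holds_hasBeen : Holds R v x (hasBeen φ) ↔ ∀ y, R y x → Holds R v y φ := by
  simp [hasBeen]

@[simp] lemma holds_bigDisj [Inhabited α] (l : List (TForm α)) :
    Holds R v x (bigDisj l) ↔ ∃ φ ∈ l, Holds R v x φ := by
  induction l with
  | nil => simp [bigDisj]
  | cons φ l ih =>
    cases l with
    | nil => simp [bigDisj]
    | cons ψ l => rw [bigDisj, holds_disj, ih]; simp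

@[simp] lemma holds_bigConj [Inhabited α] (l : List (TForm α)) :
    Holds R v x (bigConj l) ↔ ∀ φ ∈ l, Holds R v x φ := by
  induction l with
  | nil => simp [bigConj, em]
  | cons φ l ih =>
    cases l with
    | nil => simp [bigConj]
    | cons ψ l => rw [bigConj, holds_conj, ih]; simp

end TForm

/-! ### Tense morphisms and satisfiability -/

/-- A map from a frame to a partial order that preserves the relation and has the back-and-forth
property in both temporal directions. -/
structure IsTenseMorphism {W P : Type} [PartialOrder P] (R : W → W → Prop) (f : W → P) :
    Prop where
  mono : ∀ {x y}, R x y → f x ≤ f y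
  forth : ∀ {x q}, f x < q → ∃ y, R x y ∧ f y = q
  back : ∀ {y p}, p < f y → ∃ x, R x y ∧ f x = p

namespace IsTenseMorphism

variable {W W' P : Type} [PartialOrder P] {R : W → W → Prop} {R' : W' → W' → Prop}

/-- Witnesses are demanded only for labels strictly above or below, so a witness can never be the
original point; and monotonicity is trivial between equal points. -/
lemma ne_iff {f : W → P} :
    IsTenseMorphism (fun a b => R a b ∧ a ≠ b) f ↔ IsTenseMorphism R f := by
  constructor
  · intro h
    refine ⟨fun {x y} hxy => ?_, fun hq => ?_, fun hp => ?_⟩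
    · by_cases e : x = y
      · rw [e]
      · exact h.mono ⟨hxy, e⟩
    · obtain ⟨y, hy, e⟩ := h.forth hq
      exact ⟨y, hy.1, e⟩
    · obtain ⟨y, hy, e⟩ := h.back hp
      exact ⟨y, hy.1, e⟩
  · intro h
    refine ⟨fun hxy => h.mono hxy.1, fun hq => ?_, fun hp => ?_⟩
    · obtain ⟨y, hy, e⟩ := h.forth hq
      exact ⟨y, ⟨hy, fun e' => by subst e'; exact hq.ne e⟩, e⟩
    · obtain ⟨y, hy, e⟩ := h.back hp
      exact ⟨y, ⟨hy, fun e' => by subst e'; exact hp.ne e.symm⟩, e⟩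

lemma comp_equiv {f : W' → P} (hf : IsTenseMorphism R' f) (e : W ≃ W')
    (he : ∀ a b, R a b ↔ R' (e a) (e b)) : IsTenseMorphism R (f ∘ e) := by
  refine ⟨fun h => hf.mono ((he _ _).1 h), fun hq => ?_, fun hp => ?_⟩
  · obtain ⟨y, hy, h⟩ := hf.forth hq
    exact ⟨e.symm y, (he _ _).2 (by simpa using hy), by simpa using h⟩
  · obtain ⟨y, hy, h⟩ := hf.back hp
    exact ⟨e.symm y, (he _ _).2 (by simpa using hy), by simpa using h⟩

lemma exists_iff_of_equiv (e : W ≃ W') (he : ∀ a b, R a b ↔ R' (e a) (e b)) :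
    (∃ f : W → P, IsTenseMorphism R f) ↔ ∃ f : W' → P, IsTenseMorphism R' f :=
  ⟨fun ⟨f, hf⟩ => ⟨f ∘ e.symm, hf.comp_equiv e.symm fun a b => by simp [he]⟩,
    fun ⟨f, hf⟩ => ⟨f ∘ e, hf.comp_equiv e he⟩⟩

end IsTenseMorphism

open TForm in
/-- In a directed frame, `Δ(P)` describes the tense morphisms onto `P`. -/
theorem satisfiableIn_deltaFormula_iff {W P : Type} [Nonempty W] [PartialOrder P] [Fintype P]
    [Inhabited P] {R : W → W → Prop} (hR : ∀ x z, ∃ y, R x y ∧ R z y) :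
    SatisfiableIn R (deltaFormula P) ↔ ∃ f : W → P, IsTenseMorphism R f := by
  constructor
  · rintro ⟨v, x, h⟩
    replace h : ∀ z, (∃ p, z ∈ v p) ∧ (∀ p q, p ≠ q → ¬ (z ∈ v p ∧ z ∈ v q)) ∧
        (∀ p q, p < q → (z ∈ v p → ∃ y, R z y ∧ y ∈ v q) ∧ (z ∈ v q → ∃ y, R y z ∧ y ∈ v p)) ∧
        (∀ p q, p ≠ q → ¬ p < q → z ∈ v p → ∀ y, R z y → y ∉ v q) := by
      intro z
      -- By directedness `z` precedes a successor of `x`, so the body under `G H` holds at `z`.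
      obtain ⟨y, hxy, hzy⟩ := hR x z
      simp only [deltaFormula, holds_always, holds_hasBeen] at h
      have := h y hxy z hzy
      simp only [holds_bigConj, List.mem_cons, List.not_mem_nil, or_false, forall_eq_or_imp,
        forall_eq, holds_bigDisj, List.mem_map, List.mem_filter, Finset.mem_toList,
        Finset.mem_filter, Finset.mem_univ, true_and, decide_eq_true_eq, forall_exists_index,
        and_imp, Prod.forall, exists_exists_eq_and, holds_letter] at this
      obtain ⟨h1, h2, h3, h4⟩ := this
      refine ⟨h1, fun p q hpq => ?_, fun p q hpq => ?_, fun p q hpq hn => ?_⟩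
      · simpa using h2 _ p q hpq rfl
      · simpa using h3 _ p q hpq.ne hpq rfl
      · have := h4 _ p q hpq hn rfl
        simp only [holds_conj, holds_imp, holds_letter, holds_always, holds_neg] at this
        exact this.1
    choose f hf using fun z => (h z).1
    have huniq : ∀ {z p}, z ∈ v p → f z = p := fun {z p} hz => by
      by_contra hne
      exact (h z).2.1 _ _ hne ⟨hf z, hz⟩
    refine ⟨f, fun {x y} hxy => ?_, fun {x q} hq => ?_, fun {x q} hq => ?_⟩
    · by_contra hn
      exact (h x).2.2.2 (f x) (f y) (fun e => hn e.le) (fun e => hn e.le) (hf x) y hxy (hf y)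
    · obtain ⟨y, hy, hyq⟩ := ((h x).2.2.1 _ _ hq).1 (hf x)
      exact ⟨y, hy, huniq hyq⟩
    · obtain ⟨y, hy, hyq⟩ := ((h x).2.2.1 _ _ hq).2 (hf x)
      exact ⟨y, hy, huniq hyq⟩
  · rintro ⟨f, hf⟩
    refine ⟨fun p => {z | f z = p}, Classical.arbitrary W, ?_⟩
    simp only [deltaFormula, holds_always, holds_hasBeen]
    intro y _ z _
    simp only [holds_bigConj, List.mem_cons, List.not_mem_nil, or_false, forall_eq_or_imp,
        forall_eq, holds_bigDisj, List.mem_map, List.mem_filter, Finset.mem_toList,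
        Finset.mem_filter, Finset.mem_univ, true_and, decide_eq_true_eq, forall_exists_index,
        and_imp, Prod.forall, exists_exists_eq_and, holds_letter]
    refine ⟨⟨f z, rfl⟩, ?_, ?_, ?_⟩
    · rintro _ p q hpq rfl
      simp only [holds_neg, holds_conj, holds_letter, Set.mem_ofPred_eq]
      rintro ⟨rfl, h⟩
      exact hpq h
    · rintro _ p q - hpq rfl
      simp only [holds_conj, holds_imp, holds_letter, holds_future, holds_past, Set.mem_ofPred_eq]
      exact ⟨by rintro rfl; exact hf.forth hpq, by rintro rfl; exact hf.back hpq⟩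
    · rintro _ p q hpq hn rfl
      simp only [holds_conj, holds_imp, holds_letter, holds_always, holds_hasBeen, holds_neg,
        Set.mem_ofPred_eq]
      constructor
      · rintro rfl y hy rfl
        exact hn (lt_of_le_of_ne (hf.mono hy) hpq)
      · rintro rfl y hy rfl
        exact hn (lt_of_le_of_ne (hf.mono hy) hpq)

theorem satisfiableIn_ne_deltaFormula_iff {W P : Type} [Nonempty W] [PartialOrder P] [Fintype P]
    [Inhabited P] {R : W → W → Prop} (hR : ∀ x z, ∃ y, (R x y ∧ x ≠ y) ∧ (R z y ∧ z ≠ y)) :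
    TForm.SatisfiableIn (fun a b => R a b ∧ a ≠ b) (deltaFormula P) ↔
      ∃ f : W → P, IsTenseMorphism R f := by
  rw [satisfiableIn_deltaFormula_iff hR]
  simp only [IsTenseMorphism.ne_iff]

/-! ### Directedness and light-like coordinates -/

namespace Minkowski

variable {K : Type} [Field K] [LinearOrder K] [IsStrictOrderedRing K] {d : ℕ}

lemma exists_strictCausal (x z : Minkowski K d) :
    ∃ y, StrictCausal K d x y ∧ StrictCausal K d z y := by
  set s := ∑ i, (x.1 i - z.1 i) ^ 2 with hs
  have h0 : 0 ≤ s := Finset.sum_nonneg fun i _ => sq_nonneg _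
  have h1 := le_max_left x.2 z.2
  have h2 := le_max_right x.2 z.2
  refine ⟨(x.1, max x.2 z.2 + 1 + s), ⟨⟨by dsimp only; linarith, ?_⟩, fun h => ?_⟩,
    ⟨⟨by dsimp only; linarith, ?_⟩, fun h => ?_⟩⟩
  · simpa using sq_nonneg _
  · have := congrArg Prod.snd h
    dsimp only at this
    linarith
  · dsimp only
    rw [← hs]
    nlinarith
  · have := congrArg Prod.snd h
    dsimp only at this
    linarith

lemma exists_strictLightCausal (x z : K × K) :
    ∃ y, StrictLightCausal K x y ∧ StrictLightCausal K z y := by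
  have h1 := le_max_left x.1 z.1
  have h2 := le_max_right x.1 z.1
  have h3 := le_max_left x.2 z.2
  have h4 := le_max_right x.2 z.2
  refine ⟨(max x.1 z.1 + 1, max x.2 z.2 + 1), ⟨⟨?_, ?_⟩, fun h => ?_⟩, ⟨⟨?_, ?_⟩, fun h => ?_⟩⟩
  · dsimp only; linarith
  · dsimp only; linarith
  · have := congrArg Prod.fst h
    dsimp only at this
    linarith
  · dsimp only; linarith
  · dsimp only; linarith
  · have := congrArg Prod.fst h
    dsimp only at this
    linarith

variable {P : Type} [PartialOrder P] [Fintype P] [Inhabited P]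

theorem satisfiableIn_causal_iff :
    TForm.SatisfiableIn (Causal K d) (deltaFormula P) ↔
      ∃ f : Minkowski K d → P, IsTenseMorphism (Causal K d) f :=
  satisfiableIn_deltaFormula_iff fun x z =>
    let ⟨y, h1, h2⟩ := exists_strictCausal x z; ⟨y, h1.1, h2.1⟩

theorem satisfiableIn_strictCausal_iff :
    TForm.SatisfiableIn (StrictCausal K d) (deltaFormula P) ↔
      ∃ f : Minkowski K d → P, IsTenseMorphism (Causal K d) f :=
  satisfiableIn_ne_deltaFormula_iff exists_strictCausal

theorem satisfiableIn_lightCausal_iff :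
    TForm.SatisfiableIn (LightCausal K) (deltaFormula P) ↔
      ∃ f : K × K → P, IsTenseMorphism (LightCausal K) f :=
  satisfiableIn_deltaFormula_iff fun x z =>
    let ⟨y, h1, h2⟩ := exists_strictLightCausal x z; ⟨y, h1.1, h2.1⟩

theorem satisfiableIn_strictLightCausal_iff :
    TForm.SatisfiableIn (StrictLightCausal K) (deltaFormula P) ↔
      ∃ f : K × K → P, IsTenseMorphism (LightCausal K) f :=
  satisfiableIn_ne_deltaFormula_iff exists_strictLightCausal

/-- Light-line coordinates on two-dimensional spacetime. -/
def lightEquiv (K : Type) [Field K] [LinearOrder K] [IsStrictOrderedRing K] :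
    Minkowski K 1 ≃ K × K where
  toFun a := (a.2 + a.1 0, a.2 - a.1 0)
  invFun b := (fun _ => (b.1 - b.2) / 2, (b.1 + b.2) / 2)
  left_inv a := by
    refine Prod.ext (funext fun i => ?_) ?_
    · fin_cases i; dsimp; ring
    · dsimp; ring
  right_inv b := by ext <;> dsimp <;> ring

lemma causal_one_iff (a b : Minkowski K 1) :
    Causal K 1 a b ↔ LightCausal K (lightEquiv K a) (lightEquiv K b) := by
  simp only [Causal, LightCausal, lightEquiv, Equiv.coe_fn_mk, Finset.univ_unique,
    Fin.default_eq_zero, Finset.sum_singleton]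
  constructor
  · rintro ⟨h1, h2⟩
    have := abs_le.1 (abs_le_of_sq_le_sq h2 (sub_nonneg.2 h1))
    constructor <;> linarith
  · rintro ⟨h1, h2⟩
    refine ⟨by linarith, sq_le_sq' ?_ ?_⟩ <;> linarith

/-- The causal order of three-dimensional spacetime in coordinates with two light-like axes. -/
def LightCausal₃ (K : Type) [Field K] [LinearOrder K] (a b : K × K × K) : Prop :=
  a.1 ≤ b.1 ∧ a.2.1 ≤ b.2.1 ∧ (b.2.2 - a.2.2) ^ 2 ≤ (b.1 - a.1) * (b.2.1 - a.2.1)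

/-- Coordinates with two light-like axes on three-dimensional spacetime. -/
def lightEquiv₃ (K : Type) [Field K] [LinearOrder K] [IsStrictOrderedRing K] :
    Minkowski K 2 ≃ K × K × K where
  toFun a := (a.2 + a.1 0, a.2 - a.1 0, a.1 1)
  invFun b := (![(b.1 - b.2.1) / 2, b.2.2], (b.1 + b.2.1) / 2)
  left_inv a := by
    refine Prod.ext (funext fun i => ?_) ?_
    · fin_cases i
      · dsimp; ring
      · rfl
    · dsimp; ring
  right_inv b := by
    refine Prod.ext ?_ (Prod.ext ?_ rfl) <;> dsimp <;> ring

/-- Time squared minus the first space component squared factors into the two light-like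
differences, leaving the other space component alone. -/
lemma causal_two_iff (a b : Minkowski K 2) :
    Causal K 2 a b ↔ LightCausal₃ K (lightEquiv₃ K a) (lightEquiv₃ K b) := by
  simp only [Causal, LightCausal₃, lightEquiv₃, Equiv.coe_fn_mk, Fin.sum_univ_two]
  constructor
  · rintro ⟨h1, h2⟩
    have h3 : (b.1 0 - a.1 0) ^ 2 ≤ (b.2 - a.2) ^ 2 := by
      linarith [sq_nonneg (b.1 1 - a.1 1)]
    have := abs_le.1 (abs_le_of_sq_le_sq h3 (sub_nonneg.2 h1))
    exact ⟨by linarith, by linarith, by linarith⟩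
  · rintro ⟨h1, h2, h3⟩
    exact ⟨by linarith, by linarith⟩

end Minkowski

/-! ### Order theory of the two posets -/

lemma isLUB_pair_iff {P : Type} [PartialOrder P] {a b c : P} :
    IsLUB {a, b} c ↔ (a ≤ c ∧ b ≤ c) ∧ ∀ d, a ≤ d → b ≤ d → c ≤ d := by
  simp [IsLUB, IsLeast, lowerBounds, upperBounds]

lemma isGLB_pair_iff {P : Type} [PartialOrder P] {a b c : P} :
    IsGLB {a, b} c ↔ (c ≤ a ∧ c ≤ b) ∧ ∀ d, d ≤ a → d ≤ b → d ≤ c := by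
  simp [IsGLB, IsGreatest, lowerBounds, upperBounds]

namespace Poset1

lemma le_def (a b : Poset1) : a ≤ b ↔ le a b := Iff.rfl

lemma lt_def (a b : Poset1) : a < b ↔ le a b ∧ ¬ le b a := Iff.rfl

lemma u_le (a : Poset1) : u ≤ a := by cases a <;> simp [le_def, le]

lemma le_s (a : Poset1) : a ≤ s := by cases a <;> simp [le_def, le]

lemma le_or_le_or_bounds (a b : Poset1) :
    a ≤ b ∨ b ≤ a ∨ (∀ c, a ≤ c → b ≤ c → c = s) ∧ ∀ c, c ≤ a → c ≤ b → c = u := by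
  by_cases h1 : a ≤ b
  · exact Or.inl h1
  by_cases h2 : b ≤ a
  · exact Or.inr (Or.inl h2)
  refine Or.inr (Or.inr ⟨fun c => ?_, fun c => ?_⟩) <;>
  · revert h1 h2
    cases a <;> cases b <;> cases c <;> simp only [le_def, le] <;> grind

lemma isLatticeOrder : IsLatticeOrder Poset1 := by
  intro a b
  simp only [isLUB_pair_iff, isGLB_pair_iff]
  rcases le_or_le_or_bounds a b with h | h | ⟨h1, h2⟩
  · exact ⟨⟨b, ⟨h, le_rfl⟩, fun _ _ h => h⟩, a, ⟨le_rfl, h⟩, fun _ h _ => h⟩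
  · exact ⟨⟨a, ⟨le_rfl, h⟩, fun _ h _ => h⟩, b, ⟨h, le_rfl⟩, fun _ _ h => h⟩
  · exact ⟨⟨s, ⟨le_s a, le_s b⟩, fun d h h' => (h1 d h h').ge⟩,
      u, ⟨u_le a, u_le b⟩, fun d h h' => (h2 d h h').le⟩

lemma not_isDistributiveOrder : ¬ IsDistributiveOrder Poset1 := by
  intro h
  -- The pentagon formed by one full chain and an element of another chain.
  have := h (pPlus 0) (pMinus 0) (pMinus 1) s (pPlus 0) (pMinus 0) u
  simp only [isLUB_pair_iff, isGLB_pair_iff] at this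
  have h1 := (this
    ⟨⟨le_s _, le_s _⟩, fun d => by cases d <;> simp only [le_def, le] <;> grind⟩
    ⟨⟨le_rfl, le_s _⟩, fun d h _ => h⟩
    ⟨⟨by simp [le_def, le], le_rfl⟩, fun d _ h => h⟩
    ⟨⟨u_le _, u_le _⟩, fun d => by cases d <;> simp only [le_def, le] <;> grind⟩).2
      (pMinus 0) le_rfl (u_le _)
  simp [le_def, le] at h1

end Poset1

namespace Poset2

lemma le_def (a b : Poset2) : a ≤ b ↔ a = b ∨ level a < level b := Iff.rfl

lemma lt_def (a b : Poset2) : a < b ↔ level a < level b := by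
  rw [lt_iff_le_and_ne, le_def]
  constructor
  · rintro ⟨h | h, h'⟩
    · exact absurd h h'
    · exact h
  · exact fun h => ⟨Or.inr h, fun e => by simp [e] at h⟩

/-- This failure of interpolation is what a coordinatewise join in the plane will contradict. -/
lemma not_le_two_q {c : Poset2} (h0 : p 0 ≤ c) (h1 : p 1 ≤ c) {i j : Fin 3} (hij : i ≠ j)
    (hi : c ≤ q i) (hj : c ≤ q j) : False := by
  cases c with
  | p k => simp only [le_def, level, p.injEq] at h0 h1; grind
  | _ => simp_all [le_def, level]

lemma not_isLatticeOrder : ¬ IsLatticeOrder Poset2 := by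
  intro h
  obtain ⟨c, hc⟩ := (h (p 0) (p 1)).1
  rw [isLUB_pair_iff] at hc
  exact not_le_two_q hc.1.1 hc.1.2 (i := 0) (j := 1) (by decide)
    (hc.2 _ (by simp [le_def, level]) (by simp [le_def, level]))
    (hc.2 _ (by simp [le_def, level]) (by simp [le_def, level]))

end Poset2

/-! ### Dense colourings -/

/-- A colouring of an Archimedean ordered field in `n` colours, each of them dense. -/
lemma exists_dense_colouring (K : Type) [Field K] [LinearOrder K] [IsStrictOrderedRing K]
    [Archimedean K] (n : ℕ) [NeZero n] :
    ∃ c : K → Fin n, ∀ a b, a < b → ∀ i, ∃ x, a < x ∧ x < b ∧ c x = i := by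
  classical
  let := Archimedean.floorRing K
  -- The dyadic rationals; they are dense because `K` is Archimedean.
  let D : K → Prop := fun x => ∃ (m : ℤ) (k : ℕ), x * 2 ^ k = m
  have hD : ∀ a b, a < b → ∃ x, a < x ∧ x < b ∧ D x := by
    intro a b hab
    obtain ⟨k, hk⟩ := pow_unbounded_of_one_lt (1 / (b - a)) (one_lt_two : (1 : K) < 2)
    have h2 : (0 : K) < 2 ^ k := by positivity
    rw [div_lt_iff₀ (sub_pos.2 hab)] at hk
    have h3 := Int.floor_le (a * 2 ^ k)
    have h4 := Int.lt_floor_add_one (a * 2 ^ k)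
    refine ⟨((⌊a * 2 ^ k⌋ + 1 : ℤ) : K) / 2 ^ k, ?_, ?_, ⌊a * 2 ^ k⌋ + 1, k, ?_⟩
    · rw [lt_div_iff₀ h2]; push_cast; exact h4
    · rw [div_lt_iff₀ h2]; push_cast; linarith
    · field_simp
  -- Colour `i` contains the translate of the dyadics by `i / N`. As `N` is odd and exceeds every
  -- `|i - j|`, distinct translates are disjoint. Points in no translate get colour `0`.
  let N : K := 2 * n + 1
  have hN : 0 < N := by positivity
  let Q : K → Fin n → Prop := fun x i => D (x - (i : ℕ) / N)
  have huniq : ∀ x i j, Q x i → Q x j → i = j := by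
    rintro x i j ⟨m, k, hm⟩ ⟨m', k', hm'⟩
    have key : ((2 * n + 1 : ℕ) : ℤ) * (m' * 2 ^ k - m * 2 ^ k') =
        ((i : ℕ) - (j : ℕ) : ℤ) * 2 ^ (k + k') := by
      have : ((((2 * n + 1 : ℕ) : ℤ) * (m' * 2 ^ k - m * 2 ^ k') : ℤ) : K) =
        (((i : ℕ) - (j : ℕ) : ℤ) * 2 ^ (k + k') : ℤ) := by
        push_cast
        rw [← hm, ← hm', pow_add]
        change N * _ = _
        field_simp
        ring
      exact_mod_cast this
    have hcop : IsCoprime ((2 * n + 1 : ℕ) : ℤ) (2 ^ (k + k')) := by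
      refine IsCoprime.pow_right ⟨1, -n, ?_⟩
      push_cast
      ring
    have hdvd := hcop.dvd_of_dvd_mul_right ⟨_, key.symm⟩
    have hlt : |((i : ℕ) - (j : ℕ) : ℤ)| < ((2 * n + 1 : ℕ) : ℤ) := by
      have := i.2
      have := j.2
      rw [abs_lt]
      omega
    have := Int.eq_zero_of_abs_lt_dvd hdvd hlt
    exact Fin.ext (by omega)
  refine ⟨fun x => if h : ∃ i, Q x i then h.choose else 0, fun a b hab i => ?_⟩
  obtain ⟨x, h1, h2, h3⟩ := hD (a - (i : ℕ) / N) (b - (i : ℕ) / N) (by linarith)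
  have h4 : Q (x + (i : ℕ) / N) i := by simpa [Q] using h3
  refine ⟨x + (i : ℕ) / N, by linarith, by linarith, ?_⟩
  have h5 : ∃ i', Q (x + (i : ℕ) / N) i' := ⟨i, h4⟩
  dsimp only
  rw [dif_pos h5]
  exact huniq _ _ _ h5.choose_spec h4

/-! ### The second poset and the plane -/

namespace Poset2

open Minkowski

/-- The second poset is not a tense image of two-dimensional spacetime. -/
theorem not_exists_lightCausal (K : Type) [Field K] [LinearOrder K] [IsStrictOrderedRing K] :
    ¬ ∃ f : K × K → Poset2, IsTenseMorphism (LightCausal K) f := by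
  rintro ⟨f, hf⟩
  have hmono : ∀ {x y : K × K}, x.1 ≤ y.1 → x.2 ≤ y.2 → f x ≤ f y :=
    fun h1 h2 => hf.mono ⟨h1, h2⟩
  obtain ⟨w, hw⟩ : ∃ w, f w = u := by
    by_cases h : f 0 = u
    · exact ⟨_, h⟩
    · have : u < f 0 := by
        rw [lt_def]
        cases h0 : f 0 <;> simp_all [level]
      exact (hf.back this).imp fun _ h => h.2
  obtain ⟨x, -, hx⟩ := hf.forth (x := w) (q := p 0) (by simp [hw, lt_def, level])
  have hforth : ∀ j, ∃ y, LightCausal K x y ∧ f y = q j :=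
    fun j => hf.forth (by simp [hx, lt_def, level])
  choose y hxy hy using hforth
  -- The three points form an antichain, so they descend from left to right.
  have hinc : ∀ {i j}, (y i).1 ≤ (y j).1 → i ≠ j → (y j).2 < (y i).2 := by
    intro i j h hij
    by_contra hn
    have := hmono h (not_lt.1 hn)
    rw [hy, hy, le_def] at this
    simp_all [level]
  have key : ∀ i j k, i ≠ j → j ≠ k → (y i).1 ≤ (y j).1 → (y j).1 ≤ (y k).1 → False := by
    intro i j k hij hjk h1 h2
    have h1' := hinc h1 hij
    have h2' := hinc h2 hjk
    -- Here `z` is incomparable to `x`. If `z` lies to the left, the join of the two is also below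
    -- `y i`; if to the right, it is also below `y k`.
    obtain ⟨z, hz, hfz⟩ := hf.back (y := y j) (p := p 1) (by simp [hy, lt_def, level])
    have hnx : ¬ f x ≤ f z := by simp [hx, hfz, le_def, level]
    have hnz : ¬ f z ≤ f x := by simp [hx, hfz, le_def, level]
    have hxi := hxy i
    have hxj := hxy j
    have hxk := hxy k
    simp only [LightCausal] at hz hxi hxj hxk
    rcases le_total z.1 x.1 with h | h
    · have h' : x.2 ≤ z.2 := by
        by_contra hn
        exact hnz (hmono h (not_le.1 hn).le)
      refine not_le_two_q (c := f (x.1, z.2)) ?_ ?_ hij ?_ ?_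
      · rw [← hx]; exact hmono le_rfl h'
      · rw [← hfz]; exact hmono h le_rfl
      · rw [← hy]; exact hmono hxi.1 (hz.2.trans h1'.le)
      · rw [← hy]; exact hmono hxj.1 hz.2
    · have h' : z.2 ≤ x.2 := by
        by_contra hn
        exact hnx (hmono h (not_le.1 hn).le)
      refine not_le_two_q (c := f (z.1, x.2)) ?_ ?_ hjk ?_ ?_
      · rw [← hx]; exact hmono h le_rfl
      · rw [← hfz]; exact hmono le_rfl h'
      · rw [← hy]; exact hmono hz.1 hxj.2
      · rw [← hy]; exact hmono (hz.1.trans h2) hxk.2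
  rcases le_total (y 0).1 (y 1).1 with h01 | h01 <;>
  rcases le_total (y 1).1 (y 2).1 with h12 | h12 <;>
  rcases le_total (y 0).1 (y 2).1 with h02 | h02
  · exact key 0 1 2 (by decide) (by decide) h01 h12
  · exact key 0 1 2 (by decide) (by decide) h01 h12
  · exact key 0 2 1 (by decide) (by decide) h02 h12
  · exact key 2 0 1 (by decide) (by decide) h02 h01
  · exact key 1 0 2 (by decide) (by decide) h01 h02
  · exact key 1 2 0 (by decide) (by decide) h12 h02
  · exact key 2 1 0 (by decide) (by decide) h12 h01
  · exact key 2 1 0 (by decide) (by decide) h12 h01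

/-! ### The second poset and three-dimensional spacetime -/

section Label

variable {K : Type} [Field K] [LinearOrder K]

/-- The labelling of three-dimensional spacetime by the points of the second poset. -/
def label (c : K → Fin 3) (a : K × K × K) : Poset2 :=
  if a.1 < 0 then if a.2.1 < 0 then u else p 0
  else if a.2.1 < 0 then p 1
  else if a.1 = 0 ∨ a.2.1 = 0 then q (c a.2.2) else s

variable {c : K → Fin 3} {x y v : K}

lemma label_u (hx : x < 0) (hy : y < 0) : label c (x, y, v) = u := by simp [label, hx, hy]

lemma label_p_zero (hx : x < 0) (hy : 0 ≤ y) : label c (x, y, v) = p 0 := by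
  simp [label, hx, hy.not_gt]

lemma label_p_one (hx : 0 ≤ x) (hy : y < 0) : label c (x, y, v) = p 1 := by
  simp [label, hy, hx.not_gt]

lemma label_q (hx : 0 ≤ x) (hy : 0 ≤ y) (h : x = 0 ∨ y = 0) :
    label c (x, y, v) = q (c v) := by
  simp [label, hy.not_gt, hx.not_gt, h]

lemma label_s (hx : 0 < x) (hy : 0 < y) : label c (x, y, v) = s := by
  simp [label, hy.not_gt, hx.not_gt, hx.ne', hy.ne']

lemma sign_cases (x y : K) : (x < 0 ∧ y < 0) ∨ (x < 0 ∧ 0 ≤ y) ∨ (0 ≤ x ∧ y < 0) ∨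
    (0 ≤ x ∧ 0 ≤ y ∧ (x = 0 ∨ y = 0)) ∨ (0 < x ∧ 0 < y) := by
  rcases lt_trichotomy x 0 with h | h | h <;> rcases lt_trichotomy y 0 with h' | h' | h' <;>
  simp [h, h', h.le, h'.le]

variable [IsStrictOrderedRing K]

/-- Only two boundary points of the quadrant need care: there one light-like difference vanishes,
which forces equal transverse coordinates and hence equal colours. -/
lemma label_mono {a b : K × K × K} (h : LightCausal₃ K a b) : label c a ≤ label c b := by
  obtain ⟨x, y, v⟩ := a
  obtain ⟨x', y', v'⟩ := b
  obtain ⟨h1, h2, h3⟩ := h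
  dsimp only at h1 h2 h3
  rcases sign_cases x y with ⟨hx, hy⟩ | ⟨hx, hy⟩ | ⟨hx, hy⟩ | ⟨hx, hy, hxy⟩ | ⟨hx, hy⟩ <;>
  rcases sign_cases x' y' with ⟨hx', hy'⟩ | ⟨hx', hy'⟩ | ⟨hx', hy'⟩ | ⟨hx', hy', hxy'⟩ | ⟨hx', hy'⟩
  all_goals first
    | (exfalso; linarith)
    | simp [label_u, label_p_zero, label_p_one, label_q, label_s, le_def, level, *]; done
    | skip
  · have : (x' - x) * (y' - y) = 0 := by
      rcases hxy' with rfl | rfl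
      · rw [le_antisymm h1 hx]; simp
      · rw [le_antisymm h2 hy]; simp
    rw [this] at h3
    have hv : v' = v := sub_eq_zero.1 (pow_eq_zero_iff two_ne_zero |>.1 (le_antisymm h3 (sq_nonneg _)))
    rw [label_q hx hy hxy, label_q hx' hy' hxy', hv]
  · rcases hxy' with h | h <;> linarith

/-- While one light-like coordinate gains a fixed positive amount, the other can be raised until the
product pays for any transverse displacement; so every colour on the boundary is reachable. -/
lemma exists_ge_sq_le (x v v' : K) {y : K} (hy : y < 0) :
    ∃ N, 0 ≤ N ∧ x ≤ N ∧ (v' - v) ^ 2 ≤ (N - x) * (0 - y) := by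
  have hy' : 0 < -y := by linarith
  have h1 : 0 ≤ (v' - v) ^ 2 / -y := by positivity
  refine ⟨max x 0 + (v' - v) ^ 2 / -y, ?_, ?_, ?_⟩
  · linarith [le_max_right x 0]
  · linarith [le_max_left x 0]
  · calc (v' - v) ^ 2 = (v' - v) ^ 2 / -y * (0 - y) := by rw [zero_sub, div_mul_cancel₀ _ hy'.ne']
      _ ≤ _ := mul_le_mul_of_nonneg_right (by linarith [le_max_left x 0]) (by linarith)

lemma isTenseMorphism_label (hc : ∀ a b, a < b → ∀ i, ∃ x, a < x ∧ x < b ∧ c x = i) :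
    IsTenseMorphism (LightCausal₃ K) (label c) := by
  refine ⟨label_mono, ?_, ?_⟩
  · rintro ⟨x, y, v⟩ r hr
    have hcol : ∀ i, ∃ v', c v' = i := fun i =>
      let ⟨v', _, _, h⟩ := hc 0 1 one_pos i; ⟨v', h⟩
    have hs : ∃ b, LightCausal₃ K (x, y, v) b ∧ label c b = s := by
      have := le_max_left x 0
      have := le_max_right x 0
      have := le_max_left y 0
      have := le_max_right y 0
      refine ⟨(max x 0 + 1, max y 0 + 1, v), ⟨?_, ?_, ?_⟩, label_s ?_ ?_⟩
      · dsimp only; linarith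
      · dsimp only; linarith
      · dsimp only
        rw [sub_self, zero_pow two_ne_zero]
        exact mul_nonneg (by linarith) (by linarith)
      · linarith
      · linarith
    have hqx : y < 0 → ∀ i, ∃ b, LightCausal₃ K (x, y, v) b ∧ label c b = q i := by
      intro hy i
      obtain ⟨v', hv'⟩ := hcol i
      obtain ⟨N, h0, h1, h2⟩ := exists_ge_sq_le x v v' hy
      exact ⟨(N, 0, v'), ⟨h1, hy.le, h2⟩, by rw [label_q h0 le_rfl (Or.inr rfl), hv']⟩
    have hqy : x < 0 → ∀ i, ∃ b, LightCausal₃ K (x, y, v) b ∧ label c b = q i := by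
      intro hx i
      obtain ⟨v', hv'⟩ := hcol i
      obtain ⟨N, h0, h1, h2⟩ := exists_ge_sq_le y v v' hx
      exact ⟨(0, N, v'), ⟨hx.le, h1, by rw [mul_comm]; exact h2⟩,
        by rw [label_q le_rfl h0 (Or.inl rfl), hv']⟩
    rw [lt_def] at hr
    cases r with
    | u => simp [level] at hr
    | s => exact hs
    | q j =>
      rcases sign_cases x y with ⟨hx, hy⟩ | ⟨hx, hy⟩ | ⟨hx, hy⟩ | ⟨hx, hy, hxy⟩ | ⟨hx, hy⟩
      · exact hqx hy j
      · exact hqy hx j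
      · exact hqx hy j
      · simp [label_q hx hy hxy, level] at hr
      · simp [label_s hx hy, level] at hr
    | p j =>
      rcases sign_cases x y with ⟨hx, hy⟩ | ⟨hx, hy⟩ | ⟨hx, hy⟩ | ⟨hx, hy, hxy⟩ | ⟨hx, hy⟩
      · fin_cases j
        · exact ⟨(x, 0, v), ⟨le_rfl, hy.le, by simp⟩, label_p_zero hx le_rfl⟩
        · exact ⟨(0, y, v), ⟨hx.le, le_rfl, by simp⟩, label_p_one le_rfl hy⟩
      · simp [label_p_zero hx hy, level] at hr
      · simp [label_p_one hx hy, level] at hr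
      · simp [label_q hx hy hxy, level] at hr
      · simp [label_s hx hy, level] at hr
  · rintro ⟨x, y, v⟩ r hr
    have hu : ∃ b, LightCausal₃ K b (x, y, v) ∧ label c b = u := by
      have := min_le_left x 0
      have := min_le_right x 0
      have := min_le_left y 0
      have := min_le_right y 0
      refine ⟨(min x 0 - 1, min y 0 - 1, v), ⟨?_, ?_, ?_⟩, label_u ?_ ?_⟩
      · dsimp only; linarith
      · dsimp only; linarith
      · dsimp only
        rw [sub_self, zero_pow two_ne_zero]
        exact mul_nonneg (by linarith) (by linarith)
      · linarith
      · linarith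
    have hp : 0 ≤ x → 0 ≤ y → ∀ j, ∃ b, LightCausal₃ K b (x, y, v) ∧ label c b = p j := by
      intro hx hy j
      fin_cases j
      · exact ⟨(-1, y, v), ⟨by dsimp only; linarith, le_rfl, by simp⟩,
          label_p_zero (by simp) hy⟩
      · exact ⟨(x, -1, v), ⟨le_rfl, by dsimp only; linarith, by simp⟩,
          label_p_one hx (by simp)⟩
    rw [lt_def] at hr
    cases r with
    | u => exact hu
    | s => cases h : label c (x, y, v) <;> simp [h, level] at hr
    | p j =>
      rcases sign_cases x y with ⟨hx, hy⟩ | ⟨hx, hy⟩ | ⟨hx, hy⟩ | ⟨hx, hy, hxy⟩ | ⟨hx, hy⟩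
      · simp [label_u hx hy, level] at hr
      · simp [label_p_zero hx hy, level] at hr
      · simp [label_p_one hx hy, level] at hr
      · exact hp hx hy j
      · exact hp hx.le hy.le j
    | q j =>
      rcases sign_cases x y with ⟨hx, hy⟩ | ⟨hx, hy⟩ | ⟨hx, hy⟩ | ⟨hx, hy, hxy⟩ | ⟨hx, hy⟩
      · simp [label_u hx hy, level] at hr
      · simp [label_p_zero hx hy, level] at hr
      · simp [label_p_one hx hy, level] at hr
      · simp [label_q hx hy hxy, level] at hr
      -- The edge points `(0, 0, v')` with `v'` within `min x y` of `v` lie in the causal past, and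
      -- density gives all colours among them.
      · have hm : 0 < min x y := lt_min hx hy
        obtain ⟨v', h1, h2, h3⟩ := hc (v - min x y) (v + min x y) (by linarith) j
        refine ⟨(0, 0, v'), ⟨hx.le, hy.le, ?_⟩, by rw [label_q le_rfl le_rfl (Or.inl rfl), h3]⟩
        dsimp only
        calc (v - v') ^ 2 ≤ min x y ^ 2 := sq_le_sq' (by linarith) (by linarith)
          _ = min x y * min x y := sq _
          _ ≤ x * y := mul_le_mul (min_le_left _ _) (min_le_right _ _) hm.le hx.le
          _ = _ := by ring

end Label

/-- The second poset is a tense image of three-dimensional spacetime. -/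
theorem exists_causal_two (K : Type) [Field K] [LinearOrder K] [IsStrictOrderedRing K]
    [Archimedean K] : ∃ f : Minkowski K 2 → Poset2, IsTenseMorphism (Causal K 2) f := by
  obtain ⟨c, hc⟩ := exists_dense_colouring K 3
  exact ⟨_, (isTenseMorphism_label hc).comp_equiv (lightEquiv₃ K) causal_two_iff⟩

end Poset2

/-! ### Colourings of the real line -/

open Set Filter Topology in
/-- A colouring of the line in which every point has a one-sided neighbourhood of its own colour,
and a third colour occurs between any two points of different colours, is constant. -/
theorem eq_of_oneSided_of_between {ι : Type} [TopologicalSpace ι] [DiscreteTopology ι] {c : ℝ → ι}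
    (hbetween : ∀ a b, a < b → c a ≠ c b → ∃ w, a < w ∧ w < b ∧ c w ≠ c a ∧ c w ≠ c b)
    (hside : ∀ a, ∃ h > 0, (∀ r, 0 ≤ r → r ≤ h → c (a + r) = c a) ∨
      (∀ r, 0 ≤ r → r ≤ h → c (a - r) = c a)) (a b : ℝ) : c a = c b := by
  -- The points where `c` is locally constant; the goal is that `V` is everything.
  let V : Set ℝ := {x | ∀ᶠ y in 𝓝 x, c y = c x}
  have hV : IsOpen V := by
    rw [isOpen_iff_mem_nhds]
    intro x hx
    filter_upwards [hx.eventually_nhds, hx] with y hy hyx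
    filter_upwards [hy] with z hz
    rw [hz, hyx]
  have hcont : ContinuousOn c V := fun x hx =>
    ((continuousAt_const (y := c x)).congr (hx.mono fun _ h => h.symm)).continuousWithinAt
  have hconst : ∀ {l r : ℝ}, Ioo l r ⊆ V → ∀ {x y}, x ∈ Ioo l r → y ∈ Ioo l r → c x = c y :=
    fun h _ _ hx hy => isPreconnected_Ioo.constant (hcont.mono h) hx hy
  have hIoo : ∀ {l r : ℝ} {i : ι}, (∀ x ∈ Ioo l r, c x = i) → Ioo l r ∩ Vᶜ = ∅ := by
    intro l r i h
    rw [← sdiff_eq, sdiff_eq_empty]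
    intro x hx
    filter_upwards [isOpen_Ioo.mem_nhds hx] with y hy
    rw [h y hy, h x hx]
  have hside' : ∀ x, (∃ y > x, ∀ z ∈ Ico x y, c z = c x) ∨ ∃ y < x, ∀ z ∈ Ioc y x, c z = c x := by
    intro x
    obtain ⟨h, h0, H | H⟩ := hside x
    · refine Or.inl ⟨x + h, by linarith, fun z hz => ?_⟩
      have := H (z - x) (by linarith [hz.1]) (by linarith [hz.2])
      rwa [add_sub_cancel] at this
    · refine Or.inr ⟨x - h, by linarith, fun z hz => ?_⟩
      have := H (x - z) (by linarith [hz.2]) (by linarith [hz.1])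
      rwa [sub_sub_cancel] at this
  -- A one-sided interval of constant colour has its interior in `V`, so each point of `Vᶜ` is
  -- isolated in `Vᶜ` from one side; there are only countably many such points.
  have hcount : Vᶜ.Countable := by
    refine ((countable_setOfPred_isolated_right_within (s := Vᶜ)).union
      (countable_setOfPred_isolated_left_within (s := Vᶜ))).mono fun x hx => ?_
    rcases hside' x with ⟨y, hxy, hy⟩ | ⟨y, hxy, hy⟩
    · refine Or.inl ⟨hx, ?_⟩
      rw [← empty_mem_iff_bot, mem_nhdsWithin]
      refine ⟨Iio y, isOpen_Iio, hxy, ?_⟩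
      have := hIoo fun z hz => hy z (Ioo_subset_Ico_self hz)
      rw [← this]
      exact fun z hz => ⟨⟨hz.2.2, hz.1⟩, hz.2.1⟩
    · refine Or.inr ⟨hx, ?_⟩
      rw [← empty_mem_iff_bot, mem_nhdsWithin]
      refine ⟨Ioi y, isOpen_Ioi, hxy, ?_⟩
      have := hIoo fun z hz => hy z (Ioo_subset_Ioc_self hz)
      rw [← this]
      exact fun z hz => ⟨⟨hz.1, hz.2.2⟩, hz.2.1⟩
  -- Next to an isolated point of `Vᶜ` the colour is constant on each side. If it differed from that
  -- of the point, `hbetween` would produce another colour inside the same interval.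
  have hperf : Perfect Vᶜ := by
    refine ⟨hV.isClosed_compl, preperfect_iff_nhds.2 fun x hx U hU => ?_⟩
    by_contra! hiso
    obtain ⟨l, r, ⟨hl, hr⟩, hlr⟩ := mem_nhds_iff_exists_Ioo_subset.1 hU
    have hleft : Ioo l x ⊆ V := fun y hy => by
      by_contra hn
      exact hy.2.ne (hiso y ⟨hlr ⟨hy.1, hy.2.trans hr⟩, hn⟩)
    have hright : Ioo x r ⊆ V := fun y hy => by
      by_contra hn
      exact hy.1.ne' (hiso y ⟨hlr ⟨hl.trans hy.1, hy.2⟩, hn⟩)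
    have hleft' : ∀ y ∈ Ioo l x, c y = c x := by
      intro y hy
      by_contra hne
      obtain ⟨w, h1, h2, h3, -⟩ := hbetween y x hy.2 hne
      exact h3 (hconst hleft ⟨hy.1.trans h1, h2⟩ hy)
    have hright' : ∀ y ∈ Ioo x r, c y = c x := by
      intro y hy
      by_contra hne
      obtain ⟨w, h1, h2, -, h3⟩ := hbetween x y hy.1 (Ne.symm hne)
      exact h3 (hconst hright ⟨h1, h2.trans hy.2⟩ hy)
    refine hx ?_
    filter_upwards [Ioo_mem_nhds hl hr] with y hy
    rcases lt_trichotomy y x with h | rfl | h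
    · exact hleft' y ⟨hy.1, h⟩
    · rfl
    · exact hright' y ⟨h, hy.2⟩
  have huniv : V = univ := by
    rw [← compl_empty_iff]
    by_contra hne
    obtain ⟨g, hg, -, hinj⟩ := hperf.exists_nat_bool_injection (nonempty_iff_ne_empty.2 hne)
    have : (range g).Countable := hcount.mono hg
    have h1 : Countable (ℕ → Bool) := by
      rw [← countable_univ_iff]
      exact countable_of_injective_of_countable_image hinj.injOn (by rwa [image_univ])
    have h2 := Cardinal.mk_le_aleph0_iff.2 h1
    simp only [Cardinal.mk_pi, Cardinal.mk_bool, Cardinal.prod_const, Cardinal.mk_nat,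
      Cardinal.lift_id] at h2
    exact (Cardinal.cantor _).not_ge h2
  exact isPreconnected_univ.constant (huniv ▸ hcont) (mem_univ a) (mem_univ b)

/-! ### The first poset and the real plane -/

namespace Poset1

open Minkowski

/-- The points `pMinus i` and `pPlus i`. -/
def Mid (i : Fin 4) (a : Poset1) : Prop := a = pMinus i ∨ a = pPlus i

lemma eq_or_mid (a : Poset1) : a = u ∨ a = s ∨ ∃ i, Mid i a := by
  cases a <;> simp [Mid]

lemma Mid.eq_of_le {a b : Poset1} {i j : Fin 4} (ha : Mid i a) (hb : Mid j b) (h : a ≤ b) :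
    i = j := by
  rcases ha with rfl | rfl <;> rcases hb with rfl | rfl <;> simp [le_def, le] at h <;> exact h

lemma Mid.of_le_of_le {a b d : Poset1} {i : Fin 4} (ha : Mid i a) (hb : Mid i b) (h1 : a ≤ d)
    (h2 : d ≤ b) : Mid i d := by
  rcases ha with rfl | rfl <;> rcases hb with rfl | rfl <;> cases d <;>
    simp_all [le_def, le, Mid]

lemma Mid.eq_s {a b d : Poset1} {i j : Fin 4} (ha : Mid i a) (hb : Mid j b) (hij : i ≠ j)
    (h1 : a ≤ d) (h2 : b ≤ d) : d = s := by
  rcases ha with rfl | rfl <;> rcases hb with rfl | rfl <;> cases d <;>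
    simp only [le_def, le] at h1 h2 <;> grind

section

variable {f : ℝ × ℝ → Poset1}

/-- Otherwise the line splits into a part labelled `u` below a part labelled `s`. At the cut, the
middle points demanded by the morphism can lie only on the two light lines through it, and each of
these is a chain, with room for one colour. -/
lemma exists_mid_on_line (hf : IsTenseMorphism (LightCausal ℝ) f) (t : ℝ) :
    ∃ r i, Mid i (f (t + r, r)) := by
  by_contra! hno
  have hus : ∀ r, f (t + r, r) = u ∨ f (t + r, r) = s := by
    intro r
    rcases eq_or_mid (f (t + r, r)) with h | h | ⟨i, h⟩
    · exact Or.inl h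
    · exact Or.inr h
    · exact absurd h (hno r i)
  have hmono : ∀ {x y : ℝ × ℝ}, x.1 ≤ y.1 → x.2 ≤ y.2 → f x ≤ f y :=
    fun h1 h2 => hf.mono ⟨h1, h2⟩
  have hnsu : ¬ s ≤ u := by simp [le_def, le]
  have hA : ∃ r, f (t + r, r) = u := by
    rcases hus 0 with h | h
    · exact ⟨0, h⟩
    · obtain ⟨w, hw, hwu⟩ := hf.back (y := (t + 0, 0)) (p := u) (by rw [h]; simp [lt_def, le])
      refine ⟨min (w.1 - t) w.2, le_antisymm ?_ (u_le _)⟩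
      rw [← hwu]
      exact hmono (by linarith [min_le_left (w.1 - t) w.2]) (min_le_right _ _)
  have hB : ∃ r, f (t + r, r) = s := by
    rcases hus 0 with h | h
    · obtain ⟨w, hw, hws⟩ := hf.forth (x := (t + 0, 0)) (q := s) (by rw [h]; simp [lt_def, le])
      refine ⟨max (w.1 - t) w.2, le_antisymm (le_s _) ?_⟩
      rw [← hws]
      exact hmono (by linarith [le_max_left (w.1 - t) w.2]) (le_max_right _ _)
    · exact ⟨0, h⟩
  let A : Set ℝ := {r | f (t + r, r) = u}
  have hbdd : BddAbove A := by
    obtain ⟨r', hr'⟩ := hB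
    refine ⟨r', fun r hr => ?_⟩
    by_contra hlt
    have := hmono (x := (t + r', r')) (y := (t + r, r)) (by dsimp only; linarith)
      (not_le.1 hlt).le
    rw [hr', hr] at this
    exact hnsu this
  set z := sSup A
  -- Pigeonhole: three colours are already too many for two light lines.
  have hpig : ∀ m : Fin 4 → ℝ × ℝ, (∀ i, Mid i (f (m i))) →
      (∀ i, (m i).1 = t + z ∨ (m i).2 = z) → False := by
    intro m hm hline
    have h1 : ∀ i j, i ≠ j → (m i).1 = t + z → (m j).1 = t + z → False := by
      intro i j hij hi hj
      rcases le_total (m i).2 (m j).2 with h | h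
      · exact hij ((hm i).eq_of_le (hm j) (hmono (hi.trans hj.symm).le h))
      · exact hij ((hm j).eq_of_le (hm i) (hmono (hj.trans hi.symm).le h)).symm
    have h2 : ∀ i j, i ≠ j → (m i).2 = z → (m j).2 = z → False := by
      intro i j hij hi hj
      rcases le_total (m i).1 (m j).1 with h | h
      · exact hij ((hm i).eq_of_le (hm j) (hmono h (hi.trans hj.symm).le))
      · exact hij ((hm j).eq_of_le (hm i) (hmono h (hj.trans hi.symm).le)).symm
    have h01 : (0 : Fin 4) ≠ 1 := by decide
    have h02 : (0 : Fin 4) ≠ 2 := by decide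
    have h12 : (1 : Fin 4) ≠ 2 := by decide
    rcases hline 0 with h | h <;> rcases hline 1 with h' | h' <;> rcases hline 2 with h'' | h''
    · exact h1 _ _ h01 h h'
    · exact h1 _ _ h01 h h'
    · exact h1 _ _ h02 h h''
    · exact h2 _ _ h12 h' h''
    · exact h1 _ _ h12 h' h''
    · exact h2 _ _ h02 h h''
    · exact h2 _ _ h01 h h'
    · exact h2 _ _ h01 h h'
  rcases hus z with h | h
  · have hm : ∀ i, ∃ m, LightCausal ℝ (t + z, z) m ∧ f m = pMinus i :=
      fun i => hf.forth (by simp [h, lt_def, le])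
    choose m hm hfm using hm
    refine hpig m (fun i => Or.inl (hfm i)) fun i => ?_
    by_contra! hn
    have h1 : t + z < (m i).1 := lt_of_le_of_ne (hm i).1 hn.1.symm
    have h2 : z < (m i).2 := lt_of_le_of_ne (hm i).2 hn.2.symm
    -- Off the light lines, `m i` lies above a point of the line beyond the cut, which is labelled
    -- `s`.
    have h3 : z < min ((m i).1 - t) (m i).2 := lt_min (by linarith) h2
    rcases hus (min ((m i).1 - t) (m i).2) with h4 | h4
    · exact h3.not_ge (le_csSup hbdd h4)
    · have := hmono (y := m i) (x := (t + min ((m i).1 - t) (m i).2, min ((m i).1 - t) (m i).2))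
        (by linarith [min_le_left ((m i).1 - t) (m i).2]) (min_le_right _ _)
      rw [h4, hfm] at this
      simp [le_def, le] at this
  · have hm : ∀ i, ∃ m, LightCausal ℝ m (t + z, z) ∧ f m = pPlus i :=
      fun i => hf.back (by simp [h, lt_def, le])
    choose m hm hfm using hm
    refine hpig m (fun i => Or.inr (hfm i)) fun i => ?_
    by_contra! hn
    have h1 : (m i).1 < t + z := lt_of_le_of_ne (hm i).1 hn.1
    have h2 : (m i).2 < z := lt_of_le_of_ne (hm i).2 hn.2
    have h3 : max ((m i).1 - t) (m i).2 < z := max_lt (by linarith) h2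
    obtain ⟨r, hr, hlt⟩ := exists_lt_of_lt_csSup hA h3
    have := hmono (x := m i) (y := (t + r, r))
      (by linarith [le_max_left ((m i).1 - t) (m i).2])
      ((le_max_right ((m i).1 - t) (m i).2).trans hlt.le)
    rw [show f (t + r, r) = u from hr, hfm] at this
    simp [le_def, le] at this

/-- The first poset is not a tense image of real two-dimensional spacetime. -/
theorem not_exists_lightCausal_real :
    ¬ ∃ f : ℝ × ℝ → Poset1, IsTenseMorphism (LightCausal ℝ) f := by
  rintro ⟨f, hf⟩
  have hmono : ∀ {x y : ℝ × ℝ}, x.1 ≤ y.1 → x.2 ≤ y.2 → f x ≤ f y :=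
    fun h1 h2 => hf.mono ⟨h1, h2⟩
  choose r c hrc using exists_mid_on_line hf
  -- Points of one line `x - y = t` are comparable, so the colour depends on `t` alone.
  have hc : ∀ {m : ℝ × ℝ} {i}, Mid i (f m) → c (m.1 - m.2) = i := by
    intro m i hm
    have h0 := hrc (m.1 - m.2)
    rcases le_total (r (m.1 - m.2)) m.2 with h | h
    · exact h0.eq_of_le hm (hmono (by dsimp only; linarith) h)
    · exact (hm.eq_of_le h0 (hmono (by dsimp only; linarith) h)).symm
  -- A middle point has a partner of its own chain above or below it, and everything between them
  -- has that colour. The box between them contains a horizontal or vertical segment from the point,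
  -- along which `x - y` moves strictly to one side.
  have hside : ∀ a, ∃ h > 0, (∀ r, 0 ≤ r → r ≤ h → c (a + r) = c a) ∨
      (∀ r, 0 ≤ r → r ≤ h → c (a - r) = c a) := by
    intro a
    set z : ℝ × ℝ := (a + r a, r a) with hz
    have hza : z.1 - z.2 = a := by simp [hz]
    have hzm : Mid (c a) (f z) := hrc a
    rcases hrc a with h | h
    · obtain ⟨w, hzw, hw⟩ := hf.forth (x := z) (q := pPlus (c a)) (by rw [h]; simp [lt_def, le])
      have hwm : Mid (c a) (f w) := Or.inr hw
      rcases hzw.1.lt_or_eq with h1 | h1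
      · refine ⟨w.1 - z.1, by linarith, Or.inl fun q h0 hq => ?_⟩
        have := hc (m := (z.1 + q, z.2)) (hzm.of_le_of_le hwm (hmono (by simpa using h0) le_rfl)
          (hmono (by dsimp only; linarith) hzw.2))
        rw [← this]; congr 1; rw [← hza]; ring
      · have h2 : z.2 < w.2 := lt_of_le_of_ne hzw.2 fun h2 => by
          have : z = w := Prod.ext h1 h2
          rw [← this, h] at hw
          simp at hw
        refine ⟨w.2 - z.2, by linarith, Or.inr fun q h0 hq => ?_⟩
        have := hc (m := (z.1, z.2 + q)) (hzm.of_le_of_le hwm (hmono le_rfl (by simpa using h0))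
          (hmono hzw.1 (by dsimp only; linarith)))
        rw [← this]; congr 1; rw [← hza]; ring
    · obtain ⟨w, hzw, hw⟩ := hf.back (y := z) (p := pMinus (c a)) (by rw [h]; simp [lt_def, le])
      have hwm : Mid (c a) (f w) := Or.inl hw
      rcases hzw.1.lt_or_eq with h1 | h1
      · refine ⟨z.1 - w.1, by linarith, Or.inr fun q h0 hq => ?_⟩
        have := hc (m := (z.1 - q, z.2)) (hwm.of_le_of_le hzm
          (hmono (by dsimp only; linarith) hzw.2) (hmono (by simpa using h0) le_rfl))
        rw [← this]; congr 1; rw [← hza]; ring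
      · have h2 : w.2 < z.2 := lt_of_le_of_ne hzw.2 fun h2 => by
          have : w = z := Prod.ext h1 h2
          rw [this, h] at hw
          simp at hw
        refine ⟨z.2 - w.2, by linarith, Or.inl fun q h0 hq => ?_⟩
        have := hc (m := (z.1, z.2 - q)) (hwm.of_le_of_le hzm
          (hmono hzw.1 (by dsimp only; linarith)) (hmono le_rfl (by simpa using h0)))
        rw [← this]; congr 1; rw [← hza]; ring
  have hinc : ∀ {m n : ℝ × ℝ} {i j}, Mid i (f m) → Mid j (f n) → i ≠ j →
      ¬ (m.1 ≤ n.1 ∧ m.2 ≤ n.2) := fun hm hn hij h => hij (hm.eq_of_le hn (hmono h.1 h.2))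
  have hbetween : ∀ a b, a < b → c a ≠ c b → ∃ w, a < w ∧ w < b ∧ c w ≠ c a ∧ c w ≠ c b := by
    intro a b hab hne
    obtain ⟨i, hia⟩ : ∃ i, i ≠ c a ∧ i ≠ c b := by
      generalize c a = j, c b = k
      revert j k
      decide
    have ha := hrc a
    have hb := hrc b
    set y : ℝ × ℝ := (a + r a, r a) with hy
    set x : ℝ × ℝ := (b + r b, r b) with hx
    have hya : y.1 - y.2 = a := by simp [hy]
    have hxb : x.1 - x.2 = b := by simp [hx]
    have h1 : y.1 < x.1 := by
      by_contra hn
      exact hinc hb ha hne.symm ⟨not_lt.1 hn, by linarith⟩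
    have h2 : x.2 < y.2 := by
      by_contra hn
      exact hinc ha hb hne ⟨h1.le, not_lt.1 hn⟩
    -- The join of the two points bounds different chains, so it is labelled `s` and has a third
    -- colour below it. That third point is below neither `x` nor `y`, which confines it between the
    -- two lines.
    have hs : f (x.1, y.2) = s := ha.eq_s hb hne (hmono h1.le le_rfl) (hmono le_rfl h2.le)
    obtain ⟨m, hm, hfm⟩ := hf.back (y := (x.1, y.2)) (p := pMinus i) (by simp [hs, lt_def, le])
    have hmm : Mid i (f m) := Or.inl hfm
    have h3 : y.1 < m.1 := by
      by_contra hn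
      exact hinc hmm ha hia.1 ⟨not_lt.1 hn, hm.2⟩
    have h4 : x.2 < m.2 := by
      by_contra hn
      exact hinc hmm hb hia.2 ⟨hm.1, not_lt.1 hn⟩
    refine ⟨m.1 - m.2, ?_, ?_, by rwa [hc hmm]⟩
    · have := hm.2; dsimp only at this; linarith
    · have := hm.1; dsimp only at this; linarith
  have hcol : ∀ i, ∃ a, c a = i := by
    intro i
    obtain ⟨w, hw⟩ : ∃ w, f w = u := by
      by_cases h : f 0 = u
      · exact ⟨_, h⟩
      · have : u < f 0 := lt_of_le_of_ne (u_le _) (Ne.symm h)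
        exact (hf.back this).imp fun _ h => h.2
    obtain ⟨m, -, hm⟩ := hf.forth (x := w) (q := pMinus i) (by simp [hw, lt_def, le])
    exact ⟨_, hc (Or.inl hm)⟩
  obtain ⟨a, ha⟩ := hcol 0
  obtain ⟨b, hb⟩ := hcol 1
  have := eq_of_oneSided_of_between hbetween hside a b
  rw [ha, hb] at this
  exact absurd this (by decide)

end

end Poset1

/-! ### The first poset and the rational plane -/

namespace Poset1

open Minkowski

section Label

variable (e : ℚ ≃o ℚ ×ₗ ℚ) (c : ℚ → Fin 4)

/-- The first lexicographic coordinate. -/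
def major (x : ℚ) : ℚ := (ofLex (e x)).1

/-- The second lexicographic coordinate. -/
def minor (x : ℚ) : ℚ := (ofLex (e x)).2

/-- The rational with given lexicographic coordinates. -/
def point (k r : ℚ) : ℚ := e.symm (toLex (k, r))

@[simp] lemma major_point (k r : ℚ) : major e (point e k r) = k := by simp [major, point]

@[simp] lemma minor_point (k r : ℚ) : minor e (point e k r) = r := by simp [minor, point]

lemma le_iff_major_minor (x y : ℚ) :
    x ≤ y ↔ major e x < major e y ∨ major e x = major e y ∧ minor e x ≤ minor e y := by
  rw [← e.le_iff_le, Prod.Lex.le_iff]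
  rfl

lemma major_mono {x y : ℚ} (h : x ≤ y) : major e x ≤ major e y := by
  rcases (le_iff_major_minor e x y).1 h with h | h
  · exact h.le
  · exact h.1.le

/-- The labelling of rational two-dimensional spacetime by the points of the first poset. -/
def label (a : ℚ × ℚ) : Poset1 :=
  if major e a.1 + major e a.2 < 0 then u
  else if 0 < major e a.1 + major e a.2 then s
  else if minor e a.1 < 0 then pMinus (c (major e a.1)) else pPlus (c (major e a.1))

variable {e c} {x y : ℚ}

lemma label_u (h : major e x + major e y < 0) : label e c (x, y) = u := by simp [label, h]

lemma label_s (h : 0 < major e x + major e y) : label e c (x, y) = s := by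
  simp [label, h, h.not_gt]

lemma label_pMinus (h : major e x + major e y = 0) (hm : minor e x < 0) :
    label e c (x, y) = pMinus (c (major e x)) := by
  simp [label, h, hm]

lemma label_pPlus (h : major e x + major e y = 0) (hm : 0 ≤ minor e x) :
    label e c (x, y) = pPlus (c (major e x)) := by
  simp [label, h, hm.not_gt]

lemma label_cases (e : ℚ ≃o ℚ ×ₗ ℚ) (x y : ℚ) : major e x + major e y < 0 ∨
    0 < major e x + major e y ∨ (major e x + major e y = 0 ∧ minor e x < 0) ∨
    (major e x + major e y = 0 ∧ 0 ≤ minor e x) := by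
  rcases lt_trichotomy (major e x + major e y) 0 with h | h | h
  · exact Or.inl h
  · rcases lt_or_ge (minor e x) 0 with h' | h'
    · exact Or.inr (Or.inr (Or.inl ⟨h, h'⟩))
    · exact Or.inr (Or.inr (Or.inr ⟨h, h'⟩))
  · exact Or.inr (Or.inl h)

/-- If the major sums of both points are zero, both major coordinates agree, since neither can
decrease. So the colour is kept, and the minor coordinate of the first component can only grow. -/
lemma label_mono {a b : ℚ × ℚ} (h : LightCausal ℚ a b) : label e c a ≤ label e c b := by
  obtain ⟨x, y⟩ := a
  obtain ⟨x', y'⟩ := b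
  obtain ⟨h1, h2⟩ := h
  dsimp only at h1 h2
  have h1' := major_mono e h1
  have h2' := major_mono e h2
  have hx := (le_iff_major_minor e x x').1 h1
  rcases label_cases e x y with h | h | ⟨h, hm⟩ | ⟨h, hm⟩
  · rw [label_u h]; exact u_le _
  · rw [label_s (x := x') (y := y') (by linarith)]; exact le_s _
  all_goals
    rcases label_cases e x' y' with h' | h' | ⟨h', hm'⟩ | ⟨h', hm'⟩
    · linarith
    · rw [label_s h']; exact le_s _
  all_goals
    have heq : major e x = major e x' := by linarith
  · rw [label_pMinus h hm, label_pMinus h' hm', heq]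
  · rw [label_pMinus h hm, label_pPlus h' hm', heq]; simp [le_def, le]
  · rcases hx with hx | hx <;> linarith
  · rw [label_pPlus h hm, label_pPlus h' hm', heq]

lemma le_point_of_lt {x k r : ℚ} (h : major e x < k) : x ≤ point e k r := by
  rw [le_iff_major_minor e]; simp [h]

lemma point_le_of_lt {x k r : ℚ} (h : k < major e x) : point e k r ≤ x := by
  rw [le_iff_major_minor e]; simp [h]

lemma isTenseMorphism_label (hc : ∀ a b, a < b → ∀ i, ∃ x, a < x ∧ x < b ∧ c x = i) :
    IsTenseMorphism (LightCausal ℚ) (label e c) := by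
  refine ⟨label_mono, ?_, ?_⟩
  · rintro ⟨x, y⟩ r hr
    have hs : ∃ b, LightCausal ℚ (x, y) b ∧ label e c b = s := by
      have h1 := le_max_left (major e x) (-major e y)
      have h2 := le_max_right (major e x) (-major e y)
      refine ⟨(point e (max (major e x) (-major e y) + 1) 0, y),
        ⟨le_point_of_lt (by linarith), le_rfl⟩, label_s ?_⟩
      rw [major_point]
      linarith
    rcases label_cases e x y with h | h | ⟨h, hm⟩ | ⟨h, hm⟩
    -- Choosing `k` strictly between `major e x` and `-major e y` increases both major coordinates
    -- strictly, so the minor ones are free.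
    · have hk : ∀ i r, ∃ b, LightCausal ℚ (x, y) b ∧ major e b.1 + major e b.2 = 0 ∧
          minor e b.1 = r ∧ c (major e b.1) = i := by
        intro i r
        obtain ⟨k, h1, h2, h3⟩ := hc (major e x) (-major e y) (by linarith) i
        exact ⟨(point e k r, point e (-k) 0),
          ⟨le_point_of_lt h1, le_point_of_lt (by linarith)⟩, by simp, by simp, by simp [h3]⟩
      rw [label_u h] at hr
      cases r with
      | u => exact absurd hr (lt_irrefl _)
      | s => exact hs
      | pMinus i =>
        obtain ⟨b, h1, h2, h3, h4⟩ := hk i (-1)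
        exact ⟨b, h1, by rw [← h4]; exact label_pMinus h2 (by rw [h3]; norm_num)⟩
      | pPlus i =>
        obtain ⟨b, h1, h2, h3, h4⟩ := hk i 0
        exact ⟨b, h1, by rw [← h4]; exact label_pPlus h2 h3.ge⟩
    · rw [label_s h] at hr
      exact absurd hr (le_s _).not_gt
    · rw [label_pMinus h hm] at hr
      cases r with
      | u => exact absurd hr (u_le _).not_gt
      | s => exact hs
      | pMinus i => simp [lt_def, le] at hr; grind
      | pPlus i =>
        refine ⟨(point e (major e x) 0, y), ⟨?_, le_rfl⟩, ?_⟩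
        · rw [le_iff_major_minor e]; simp [hm.le]
        · rw [label_pPlus (by simpa using h) (by simp), major_point]
          simp only [lt_def, le] at hr
          rw [hr.1]
    · rw [label_pPlus h hm] at hr
      cases r with
      | u => exact absurd hr (u_le _).not_gt
      | s => exact hs
      | pMinus i => simp [lt_def, le] at hr
      | pPlus i => simp [lt_def, le] at hr; grind
  · rintro ⟨x, y⟩ r hr
    have hu : ∃ b, LightCausal ℚ b (x, y) ∧ label e c b = u := by
      have h1 := min_le_left (major e x) (-major e y)
      have h2 := min_le_right (major e x) (-major e y)
      refine ⟨(point e (min (major e x) (-major e y) - 1) 0, y),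
        ⟨point_le_of_lt (by linarith), le_rfl⟩, label_u ?_⟩
      rw [major_point]
      linarith
    rcases label_cases e x y with h | h | ⟨h, hm⟩ | ⟨h, hm⟩
    · rw [label_u h] at hr
      exact absurd hr (u_le _).not_gt
    · have hk : ∀ i r, ∃ b, LightCausal ℚ b (x, y) ∧ major e b.1 + major e b.2 = 0 ∧
          minor e b.1 = r ∧ c (major e b.1) = i := by
        intro i r
        obtain ⟨k, h1, h2, h3⟩ := hc (-major e y) (major e x) (by linarith) i
        exact ⟨(point e k r, point e (-k) 0),
          ⟨point_le_of_lt h2, point_le_of_lt (by linarith)⟩, by simp, by simp, by simp [h3]⟩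
      rw [label_s h] at hr
      cases r with
      | u => exact hu
      | s => exact absurd hr (lt_irrefl _)
      | pMinus i =>
        obtain ⟨b, h1, h2, h3, h4⟩ := hk i (-1)
        exact ⟨b, h1, by rw [← h4]; exact label_pMinus h2 (by rw [h3]; norm_num)⟩
      | pPlus i =>
        obtain ⟨b, h1, h2, h3, h4⟩ := hk i 0
        exact ⟨b, h1, by rw [← h4]; exact label_pPlus h2 h3.ge⟩
    · rw [label_pMinus h hm] at hr
      cases r with
      | u => exact hu
      | s => exact absurd hr (le_s _).not_gt
      | pMinus i => simp [lt_def, le] at hr; grind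
      | pPlus i => simp [lt_def, le] at hr
    · rw [label_pPlus h hm] at hr
      cases r with
      | u => exact hu
      | s => exact absurd hr (le_s _).not_gt
      | pMinus i =>
        refine ⟨(point e (major e x) (-1), y), ⟨?_, le_rfl⟩, ?_⟩
        · rw [le_iff_major_minor e]; simp; linarith
        · rw [label_pMinus (by simpa using h) (by simp), major_point]
          simp only [lt_def, le] at hr
          rw [hr.1]
      | pPlus i => simp [lt_def, le] at hr; grind

end Label

/-- The first poset is a tense image of rational two-dimensional spacetime. -/
theorem exists_lightCausal_rat : ∃ f : ℚ × ℚ → Poset1, IsTenseMorphism (LightCausal ℚ) f := by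
  obtain ⟨c, hc⟩ := exists_dense_colouring ℚ 4
  have : Countable (ℚ ×ₗ ℚ) := inferInstanceAs (Countable (ℚ × ℚ))
  obtain ⟨e⟩ := Order.iso_of_countable_dense ℚ (ℚ ×ₗ ℚ)
  exact ⟨_, isTenseMorphism_label (e := e) hc⟩

end Poset1

/-! ### The main theorem -/

open TForm Minkowski in
theorem mainTheorem7 :
    -- the first poset is a non-distributive lattice, the second one is not a lattice
    (IsLatticeOrder Poset1 ∧ ¬ IsDistributiveOrder Poset1 ∧ ¬ IsLatticeOrder Poset2) ∧
    -- (1), in light-line coordinates (product order)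
    (SatisfiableIn (LightCausal ℚ) (deltaFormula Poset1) ∧
      SatisfiableIn (StrictLightCausal ℚ) (deltaFormula Poset1) ∧
      ¬ SatisfiableIn (LightCausal ℝ) (deltaFormula Poset1) ∧
      ¬ SatisfiableIn (StrictLightCausal ℝ) (deltaFormula Poset1)) ∧
    -- (1), in space and time coordinates
    (SatisfiableIn (Causal ℚ 1) (deltaFormula Poset1) ∧
      SatisfiableIn (StrictCausal ℚ 1) (deltaFormula Poset1) ∧
      ¬ SatisfiableIn (Causal ℝ 1) (deltaFormula Poset1) ∧
      ¬ SatisfiableIn (StrictCausal ℝ 1) (deltaFormula Poset1)) ∧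
    -- (2) over the reals
    (SatisfiableIn (Causal ℝ 2) (deltaFormula Poset2) ∧
      SatisfiableIn (StrictCausal ℝ 2) (deltaFormula Poset2) ∧
      ¬ SatisfiableIn (LightCausal ℝ) (deltaFormula Poset2) ∧
      ¬ SatisfiableIn (StrictLightCausal ℝ) (deltaFormula Poset2) ∧
      ¬ SatisfiableIn (Causal ℝ 1) (deltaFormula Poset2) ∧
      ¬ SatisfiableIn (StrictCausal ℝ 1) (deltaFormula Poset2)) ∧
    -- (2) over the rationals
    (SatisfiableIn (Causal ℚ 2) (deltaFormula Poset2) ∧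
      SatisfiableIn (StrictCausal ℚ 2) (deltaFormula Poset2) ∧
      ¬ SatisfiableIn (LightCausal ℚ) (deltaFormula Poset2) ∧
      ¬ SatisfiableIn (StrictLightCausal ℚ) (deltaFormula Poset2) ∧
      ¬ SatisfiableIn (Causal ℚ 1) (deltaFormula Poset2) ∧
      ¬ SatisfiableIn (StrictCausal ℚ 1) (deltaFormula Poset2)) := by
  have hne : ∀ K : Type, ∀ [Field K] [LinearOrder K] [IsStrictOrderedRing K],
      ∀ P : Type, ∀ [PartialOrder P], (∃ f : Minkowski K 1 → P, IsTenseMorphism (Causal K 1) f) ↔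
        ∃ f : K × K → P, IsTenseMorphism (LightCausal K) f :=
    fun K _ _ _ P _ => IsTenseMorphism.exists_iff_of_equiv (lightEquiv K) causal_one_iff
  simp only [satisfiableIn_causal_iff, satisfiableIn_strictCausal_iff,
    satisfiableIn_lightCausal_iff, satisfiableIn_strictLightCausal_iff, hne]
  have h1 := Poset1.exists_lightCausal_rat
  have h2 := Poset1.not_exists_lightCausal_real
  have h3 := Poset2.exists_causal_two ℝ
  have h4 := Poset2.exists_causal_two ℚ
  have h5 := Poset2.not_exists_lightCausal ℝ
  have h6 := Poset2.not_exists_lightCausal ℚ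
  exact ⟨⟨Poset1.isLatticeOrder, Poset1.not_isDistributiveOrder, Poset2.not_isLatticeOrder⟩,
    ⟨h1, h1, h2, h2⟩, ⟨h1, h1, h2, h2⟩, ⟨h3, h3, h5, h5, h5, h5⟩, ⟨h4, h4, h6, h6, h6, h6⟩⟩
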